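/- Let $X$ be a real Banach space with an unconditional basis $(e_j)_{j\ge 1}$; identify each $x=\sum_j x_je_j\in X$ with its coordinate sequence $(x_j)$ and put $\operatorname{supp}(x)=\{j\ge 1: x_j\ne 0\}$. Suppose that $X$ is an *asymptotic $\ell_1$ space for vectors with disjoint supports*: there is a constant $C>0$ such that, for every $n$ and all norm-one vectors $x_1,\dots,x_n\in X$ whose supports are finite, nonempty, pairwise disjoint and such that the set of their minima $\{\min\operatorname{supp}(x_i): 1\le i\le n\}$ belongs to the Schreier family $S_1$, there are $A,B>0$ with $AB\le C$ and $$\frac1A\sum_{i=1}^n|a_i|\ \le\ \Big\|\sum_{i=1}^n a_ix_i\Big\|\ \le\ B\sum_{i=1}^n|a_i|\qquad\text{for all real } a_1,\dots,a_n.$$ Here $S_0$ consists of the empty set and the singletons $\{m\}$, $m\ge1$, and $S_{1}$ consists of all unions $F_1\cup\dots\cup F_n$ with $n\ge 1$, $F_i\in S_0$, all elements of every $F_i$ at least $n$, and every element of $F_i$ smaller than every element of $F_j$ whenever $i<j$. (Thus $S_1$ is the family of finite sets $F$ of positive integers with $F=\emptyset$ or $|F|\le\min F$.) Let $X^{(2)}$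 be the $2$-convexification of $X$: the linear space of all real sequences $x=(x_j)$ such that $x^2=(x_j^2)$ belongs to $X$, with the norm $$\|x\|_{(2)}=\Big(\sup\{\|v\|: v\in X,\ |v_j|\le x_j^2\text{ for all }j\}\Big)^{1/2}.$$ (If the norm of $X$ is a lattice norm, that is, if $|v_j|\le|u_j|$ for all $j$ implies $\|v\|\le\|u\|$, this is $\|x\|_{(2)}=\|x^2\|^{1/2}$; in general it is the same formula for the canonical equivalent lattice norm on $X$.) Then $X^{(2)}$ is a *weak Hilbert space*: it is a Banach space, and there are $\delta>0$ and $K\ge1$ such that every finite-dimensional subspace $E$ of $X^{(2)}$ contains a subspace $F$ with $\dim F\ge\delta\dim E$, such that the Banach–Mazur distance from $F$ to $\ell_2^{\dim F}$ is at most $K$ and there is a projection $P$ of $X^{(2)}$ onto $F$ with $\|P\|\le K$. -/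

import Mathlib

/-! ## Schreier families and allowable families -/

/-- The Schreier families `S_0, S_1, …` of finite sets of positive integers:
`S_0` consists of the empty set and the singletons, and `S_{k+1}` of the unions
`F_1 ∪ ⋯ ∪ F_n` with `F_i ∈ S_k`, `F_1 < F_2 < ⋯ < F_n` and `n ≤ F_i` for all `i`. -/
def schreier : ℕ → Set (Finset ℕ)
  | 0 => {F | F = ∅ ∨ ∃ m : ℕ, 1 ≤ m ∧ F = {m}}
  | k + 1 => {F | ∃ n : ℕ, 1 ≤ n ∧ ∃ E : Fin n → Finset ℕ,
      (∀ i, E i ∈ schreier k) ∧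
      (∀ i, ∀ m ∈ E i, n ≤ m) ∧
      (∀ i j, i < j → ∀ m ∈ E i, ∀ l ∈ E j, m < l) ∧
      F = Finset.univ.biUnion E}

/-- A finite family of finite nonempty sets is `S_k`-allowable if its members are pairwise
disjoint and the set of their minima belongs to `S_k`. -/
def IsAllowable (k : ℕ) {n : ℕ} (E : Fin n → Finset ℕ) : Prop :=
  (∀ i j, i ≠ j → Disjoint (E i) (E j)) ∧
  ∃ hE : ∀ i, (E i).Nonempty, Finset.univ.image (fun i => (E i).min' (hE i)) ∈ schreier k

/-! ## Asymptotic `ℓ_p` spaces -/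

section Asymptotic

variable {X : Type*} [NormedAddCommGroup X] [NormedSpace ℝ X]

/-- `(x_i)` is `C`-equivalent to the unit vector basis of `ℓ_p^n`. -/
def IsEquivLp (p C : ℝ) {n : ℕ} (x : Fin n → X) : Prop :=
  ∃ A B : ℝ, 0 < A ∧ 0 < B ∧ A * B ≤ C ∧ ∀ a : Fin n → ℝ,
    (1 / A) * (∑ i, |a i| ^ p) ^ (1 / p) ≤ ‖∑ i, a i • x i‖ ∧
    ‖∑ i, a i • x i‖ ≤ B * (∑ i, |a i| ^ p) ^ (1 / p)

/-- The support of a vector with respect to a basis, as a set of positive integers.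
Mathlib indexes a basis from `0`: the `j`-th basis vector (`j ≥ 1`) is `b (j - 1)`. -/
def basisSupport (b : UnconditionalSchauderBasis ℕ ℝ X) (x : X) : Set ℕ :=
  {j | 1 ≤ j ∧ b.coord (j - 1) x ≠ 0}

/-- `X` (with the basis `b`) is an asymptotic `ℓ_p` space for vectors with disjoint supports
with constant `C`: normalized vectors whose supports form an `S_1`-allowable family
(in particular finite supports) are `C`-equivalent to the unit vector basis of `ℓ_p^n`. -/
def IsAsymptoticLpDisjointWith (b : UnconditionalSchauderBasis ℕ ℝ X) (p C : ℝ) : Prop :=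
  ∀ (n : ℕ) (x : Fin n → X) (E : Fin n → Finset ℕ),
    (∀ i, ‖x i‖ = 1) → (∀ i, basisSupport b (x i) = (E i : Set ℕ)) → IsAllowable 1 E →
    IsEquivLp p C x

/-- `X` is an asymptotic `ℓ_p` space for vectors with disjoint supports. -/
def IsAsymptoticLpDisjoint (b : UnconditionalSchauderBasis ℕ ℝ X) (p : ℝ) : Prop :=
  ∃ C : ℝ, 0 < C ∧ IsAsymptoticLpDisjointWith b p C

end Asymptotic

/-! ## Weak Hilbert spaces -/

/-- The Banach–Mazur distance between a finite-dimensional normed space `F` and the Euclidean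
space of the same dimension. -/
noncomputable def distEuclidean (F : Type*) [NormedAddCommGroup F] [NormedSpace ℝ F] : ℝ :=
  sInf {r : ℝ | ∃ T : F ≃L[ℝ] EuclideanSpace ℝ (Fin (Module.finrank ℝ F)),
    r = ‖(T : F →L[ℝ] EuclideanSpace ℝ (Fin (Module.finrank ℝ F)))‖ *
      ‖(T.symm : EuclideanSpace ℝ (Fin (Module.finrank ℝ F)) →L[ℝ] F)‖}

/-- A weak Hilbert space: a Banach space `X` for which there are `δ > 0` and `C ≥ 1` such that
every finite-dimensional subspace `E` contains a subspace `F` with `dim F ≥ δ dim E` which is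
`C`-close to a Euclidean space and is the range of a projection `P : X → F` of norm `≤ C`. -/
def IsWeakHilbert (X : Type*) [NormedAddCommGroup X] [NormedSpace ℝ X] : Prop :=
  CompleteSpace X ∧ ∃ δ C : ℝ, 0 < δ ∧ 1 ≤ C ∧
    ∀ E : Submodule ℝ X, FiniteDimensional ℝ E →
      ∃ F : Submodule ℝ X, F ≤ E ∧
        δ * (Module.finrank ℝ E : ℝ) ≤ (Module.finrank ℝ F : ℝ) ∧
        distEuclidean F ≤ C ∧
        ∃ P : X →L[ℝ] F, (∀ f : F, P (f : X) = f) ∧ ‖P‖ ≤ C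

/-! ## The 2-convexification -/

namespace TwoConv

variable {X : Type*} [NormedAddCommGroup X] [NormedSpace ℝ X]

theorem coord_basis_eq (b : UnconditionalSchauderBasis ℕ ℝ X) (i j : ℕ) :
    b.coord i (b j) = if i = j then 1 else 0 := by
  rw [b.ortho]
  by_cases h : i = j
  · subst h; simp
  · simp [h]

theorem ext_coord (b : UnconditionalSchauderBasis ℕ ℝ X) {u v : X}
    (h : ∀ i, b.coord i u = b.coord i v) : u = v := by
  have h1 := b.expansion u
  simp only [h] at h1
  exact h1.unique (b.expansion v)

theorem norm_sum_le (e : ℕ → X) (s t : ℕ → ℝ) (hst : ∀ i, |t i| ≤ |s i|) (F : Finset ℕ) (B : ℝ)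
    (hB : ∀ G ⊆ F, ‖∑ i ∈ G, s i • e i‖ ≤ B) : ‖∑ i ∈ F, t i • e i‖ ≤ 2 * B := by
  classical
  obtain ⟨g, hg1, hg⟩ := exists_dual_vector'' ℝ (∑ i ∈ F, t i • e i)
  have hgle : ∀ v : X, |g v| ≤ ‖v‖ := fun v => by
    have h1 := g.le_opNorm v
    rw [Real.norm_eq_abs] at h1
    nlinarith [norm_nonneg v]
  have h1 : ‖∑ i ∈ F, t i • e i‖ = ∑ i ∈ F, t i * g (e i) := by
    have : g (∑ i ∈ F, t i • e i) = ∑ i ∈ F, t i * g (e i) := by simp [map_sum]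
    rw [← this, hg]; simp
  have h2 : ∑ i ∈ F, t i * g (e i) ≤ ∑ i ∈ F, |s i * g (e i)| := by
    refine Finset.sum_le_sum fun i _ => (le_abs_self _).trans ?_
    rw [abs_mul, abs_mul]
    exact mul_le_mul_of_nonneg_right (hst i) (abs_nonneg _)
  have h3 : ∑ i ∈ F, |s i * g (e i)| =
      g (∑ i ∈ F with 0 ≤ s i * g (e i), s i • e i) -
      g (∑ i ∈ F with ¬ 0 ≤ s i * g (e i), s i • e i) := by
    rw [← Finset.sum_filter_add_sum_filter_not F (fun i => 0 ≤ s i * g (e i))]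
    simp only [map_sum, map_smul, smul_eq_mul]
    rw [sub_eq_add_neg, ← Finset.sum_neg_distrib]
    congr 1
    · exact Finset.sum_congr rfl fun i hi => abs_of_nonneg (Finset.mem_filter.1 hi).2
    · exact Finset.sum_congr rfl fun i hi =>
        abs_of_neg (not_le.1 (Finset.mem_filter.1 hi).2)
  have h4 := (le_abs_self _).trans ((hgle _).trans (hB _ (Finset.filter_subset
    (fun i => 0 ≤ s i * g (e i)) F)))
  have h5 := (neg_le_abs _).trans ((hgle _).trans (hB _ (Finset.filter_subset
    (fun i => ¬ 0 ≤ s i * g (e i)) F)))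
  linarith

variable [CompleteSpace X]

/-- Coordinate sequences of elements of `X` form a solid set. -/
theorem exists_of_abs_le (b : UnconditionalSchauderBasis ℕ ℝ X) (u : X) (t : ℕ → ℝ)
    (ht : ∀ i, |t i| ≤ |b.coord i u|) : ∃ v : X, ∀ i, b.coord i v = t i := by
  have hs : Summable fun i => t i • b i := by
    rw [summable_iff_vanishing_norm]
    intro ε hε
    obtain ⟨A, hA⟩ := summable_iff_vanishing_norm.mp (b.expansion u).summable (ε / 4) (by linarith)
    refine ⟨A, fun F hF => ?_⟩
    have := norm_sum_le b (fun i => b.coord i u) t ht F (ε / 4)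
      (fun G hG => (hA G (Finset.disjoint_of_subset_left hG hF)).le)
    linarith
  refine ⟨∑' i, t i • b i, fun i => ?_⟩
  rw [(b.coord i).map_tsum hs, tsum_eq_single i]
  · simp [coord_basis_eq]
  · intro j hj
    simp [coord_basis_eq, hj.symm]

theorem exists_norm_bound (b : UnconditionalSchauderBasis ℕ ℝ X) :
    ∃ K : ℝ, 0 ≤ K ∧ ∀ u v : X, (∀ i, |b.coord i v| ≤ |b.coord i u|) → ‖v‖ ≤ K * ‖u‖ := by
  obtain ⟨C, hC⟩ := UnconditionalSchauderBasis.exists_norm_proj_le b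
  have hC0 : 0 ≤ C := (norm_nonneg _).trans (hC ∅)
  refine ⟨2 * C, by linarith, fun u v h => ?_⟩
  refine le_of_tendsto (b.expansion v).norm (Filter.Eventually.of_forall fun F => ?_)
  have := norm_sum_le b (fun i => b.coord i u) (fun i => b.coord i v) h F (C * ‖u‖)
    (fun G _ => by
      rw [← GeneralSchauderBasis.proj_apply]
      exact (b.proj G).le_of_opNorm_le (hC G) u)
  linarith

/-- The linear space of all real sequences `x` such that `x²` is (the coordinate sequence of)
an element of `X`. -/
def carrier (b : UnconditionalSchauderBasis ℕ ℝ X) : Submodule ℝ (ℕ → ℝ) where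
  carrier := {x | ∃ u : X, ∀ i, b.coord i u = x i ^ 2}
  zero_mem' := ⟨0, fun i => by simp⟩
  add_mem' := by
    rintro x y ⟨u, hu⟩ ⟨v, hv⟩
    refine exists_of_abs_le b ((2 : ℝ) • (u + v)) _ fun i => ?_
    simp only [map_smul, map_add, hu, hv, Pi.add_apply, smul_eq_mul]
    rw [abs_of_nonneg (sq_nonneg _), abs_of_nonneg (by positivity)]
    nlinarith [sq_nonneg (x i - y i)]
  smul_mem' := by
    rintro c x ⟨u, hu⟩
    exact ⟨c ^ 2 • u, fun i => by simp [hu, mul_pow]⟩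

end TwoConv

/-- The 2-convexification `X^{(2)}` of a Banach space `X` with an unconditional basis: the space
of the real sequences `x` with `x² ∈ X`. Its norm is defined below. -/
def TwoConvexification {X : Type*} [NormedAddCommGroup X] [NormedSpace ℝ X] [CompleteSpace X]
    (b : UnconditionalSchauderBasis ℕ ℝ X) : Type :=
  ↥(TwoConv.carrier b)

namespace TwoConvexification

variable {X : Type*} [NormedAddCommGroup X] [NormedSpace ℝ X] [CompleteSpace X]

instance (b : UnconditionalSchauderBasis ℕ ℝ X) : AddCommGroup (TwoConvexification b) :=
  inferInstanceAs (AddCommGroup ↥(TwoConv.carrier b))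

instance (b : UnconditionalSchauderBasis ℕ ℝ X) : Module ℝ (TwoConvexification b) :=
  inferInstanceAs (Module ℝ ↥(TwoConv.carrier b))

/-- The sequence underlying an element of `X^{(2)}`. -/
def toSeq {b : UnconditionalSchauderBasis ℕ ℝ X} (x : TwoConvexification b) : ℕ → ℝ :=
  Subtype.val (p := fun y => y ∈ TwoConv.carrier b) x

section

variable {b : UnconditionalSchauderBasis ℕ ℝ X}

theorem toSeq_mem (x : TwoConvexification b) : ∃ u : X, ∀ i, b.coord i u = x.toSeq i ^ 2 :=
  Subtype.property (p := fun y => y ∈ TwoConv.carrier b) x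

theorem toSeq_injective : Function.Injective (toSeq (b := b)) := Subtype.val_injective

@[simp] theorem toSeq_zero (i : ℕ) : (0 : TwoConvexification b).toSeq i = 0 := rfl

@[simp] theorem toSeq_add (x y : TwoConvexification b) (i : ℕ) :
    (x + y).toSeq i = x.toSeq i + y.toSeq i := rfl

@[simp] theorem toSeq_smul (c : ℝ) (x : TwoConvexification b) (i : ℕ) :
    (c • x).toSeq i = c * x.toSeq i := rfl

/-- The norms of the elements `v` of `X` with `|v| ≤ x²` coordinatewise. -/
def normSet (x : TwoConvexification b) : Set ℝ :=
  {r | ∃ v : X, (∀ i, |b.coord i v| ≤ x.toSeq i ^ 2) ∧ r = ‖v‖}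

/-- The norm of `X^{(2)}`: `‖x‖_(2) = (sup {‖v‖ : v ∈ X, |v| ≤ x²})^{1/2}`. The supremum is the
norm of `x²` in the canonical equivalent lattice renorming of `X`; it is `‖x²‖` when the norm of
`X` is itself a lattice norm (see `norm_eq_sqrt`) and comparable with `‖x²‖` in
general (see `exists_norm_equiv`). -/
noncomputable instance : Norm (TwoConvexification b) where
  norm x := Real.sqrt (sSup (normSet x))

theorem norm_def (x : TwoConvexification b) : ‖x‖ = Real.sqrt (sSup (normSet x)) := rfl

theorem bddAbove_normSet (x : TwoConvexification b) : BddAbove (normSet x) := by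
  obtain ⟨K, -, hK⟩ := TwoConv.exists_norm_bound b
  obtain ⟨u, hu⟩ := x.toSeq_mem
  refine ⟨K * ‖u‖, ?_⟩
  rintro _ ⟨v, hv, rfl⟩
  exact hK u v fun i => by rw [hu, abs_of_nonneg (sq_nonneg (x.toSeq i))]; exact hv i

theorem zero_mem_normSet (x : TwoConvexification b) : (0 : ℝ) ∈ normSet x :=
  ⟨0, fun i => by simpa using sq_nonneg _, by simp⟩

theorem sq_norm (x : TwoConvexification b) : ‖x‖ ^ 2 = sSup (normSet x) :=
  Real.sq_sqrt (le_csSup (bddAbove_normSet x) (zero_mem_normSet x))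

theorem norm_le_of_abs_le (x : TwoConvexification b) (v : X) (c : ℝ) (hc : 0 ≤ c)
    (hv : ∀ i, |b.coord i v| ≤ c * x.toSeq i ^ 2) : ‖v‖ ≤ c * ‖x‖ ^ 2 := by
  rcases hc.eq_or_lt with rfl | hc
  · have : v = 0 := TwoConv.ext_coord b fun i => by
      have := hv i
      rw [zero_mul] at this
      simpa using abs_nonpos_iff.1 this
    simp [this]
  · have h : ‖c⁻¹ • v‖ ≤ ‖x‖ ^ 2 := by
      rw [sq_norm]
      refine le_csSup (bddAbove_normSet x) ⟨_, fun i => ?_, rfl⟩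
      rw [map_smul, smul_eq_mul, abs_mul, abs_of_pos (inv_pos.2 hc), inv_mul_le_iff₀ hc]
      exact hv i
    rwa [norm_smul, Real.norm_eq_abs, abs_of_pos (inv_pos.2 hc), inv_mul_le_iff₀ hc] at h

theorem sq_norm_le (x : TwoConvexification b) (M : ℝ)
    (h : ∀ v : X, (∀ i, |b.coord i v| ≤ x.toSeq i ^ 2) → ‖v‖ ≤ M) : ‖x‖ ^ 2 ≤ M := by
  rw [sq_norm]
  refine csSup_le ⟨_, zero_mem_normSet x⟩ ?_
  rintro _ ⟨v, hv, rfl⟩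
  exact h v hv

theorem norm_nonneg' (x : TwoConvexification b) : 0 ≤ ‖x‖ := Real.sqrt_nonneg _

theorem norm_smul_le' (c : ℝ) (x : TwoConvexification b) : ‖c • x‖ ≤ |c| * ‖x‖ := by
  refine abs_le_of_sq_le_sq' ?_ (mul_nonneg (abs_nonneg _) (norm_nonneg' x)) |>.2
  refine sq_norm_le _ _ fun v hv => ?_
  rw [mul_pow, sq_abs]
  exact norm_le_of_abs_le x v (c ^ 2) (sq_nonneg c) fun i => by
    simpa [mul_pow] using hv i

theorem norm_smul' (c : ℝ) (x : TwoConvexification b) : ‖c • x‖ = |c| * ‖x‖ := by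
  refine le_antisymm (norm_smul_le' c x) ?_
  rcases eq_or_ne c 0 with rfl | hc
  · simpa using norm_nonneg' _
  · have h := norm_smul_le' c⁻¹ (c • x)
    rw [smul_smul, inv_mul_cancel₀ hc, one_smul, abs_inv] at h
    rwa [← le_inv_mul_iff₀ (abs_pos.2 hc)]

theorem eq_zero_of_norm (x : TwoConvexification b) (h : ‖x‖ = 0) : x = 0 := by
  obtain ⟨u, hu⟩ := x.toSeq_mem
  have h1 : ‖u‖ ≤ 1 * ‖x‖ ^ 2 := norm_le_of_abs_le x u 1 zero_le_one fun i => by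
    rw [hu, abs_of_nonneg (sq_nonneg _), one_mul]
  have h2 : u = 0 := by
    rw [h] at h1
    exact norm_le_zero_iff.1 (by simpa using h1)
  refine toSeq_injective (funext fun i => ?_)
  have := hu i
  rw [h2, map_zero] at this
  simpa using this.symm

theorem norm_add_le' (x y : TwoConvexification b) : ‖x + y‖ ≤ ‖x‖ + ‖y‖ := by
  rcases eq_or_ne x 0 with rfl | hx
  · rw [zero_add]; linarith [norm_nonneg' (0 : TwoConvexification b)]
  rcases eq_or_ne y 0 with rfl | hy
  · rw [add_zero]; linarith [norm_nonneg' (0 : TwoConvexification b)]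
  have hx0 : 0 < ‖x‖ := (norm_nonneg' x).lt_of_ne fun h => hx (eq_zero_of_norm x h.symm)
  have hy0 : 0 < ‖y‖ := (norm_nonneg' y).lt_of_ne fun h => hy (eq_zero_of_norm y h.symm)
  refine abs_le_of_sq_le_sq' ?_ (by linarith) |>.2
  refine sq_norm_le _ _ fun v hv => ?_
  set r : ℝ := ‖y‖ / ‖x‖ with hr
  have hr0 : 0 < r := div_pos hy0 hx0
  have hri : r⁻¹ = ‖x‖ / ‖y‖ := by rw [hr, inv_div]
  have hri0 : 0 < r⁻¹ := inv_pos.2 hr0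
  let p : ℕ → ℝ := fun i => (1 + r) * x.toSeq i ^ 2
  let q : ℕ → ℝ := fun i => (1 + r⁻¹) * y.toSeq i ^ 2
  have hp : ∀ i, 0 ≤ p i := fun i => by positivity
  have hq : ∀ i, 0 ≤ q i := fun i => by positivity
  have hpq : ∀ i, |b.coord i v| ≤ p i + q i := fun i => by
    refine (hv i).trans ?_
    rw [toSeq_add]
    have h1 : 0 ≤ r⁻¹ * (r * x.toSeq i - y.toSeq i) ^ 2 := by positivity
    have h2 : r⁻¹ * (r * x.toSeq i - y.toSeq i) ^ 2 =
        r * x.toSeq i ^ 2 - 2 * x.toSeq i * y.toSeq i + r⁻¹ * y.toSeq i ^ 2 := by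
      field_simp
      ring
    simp only [p, q]
    nlinarith
  have hz : ∀ i, p i + q i = 0 → b.coord i v = 0 := fun i hi =>
    abs_nonpos_iff.1 (hi ▸ hpq i)
  obtain ⟨v1, hv1⟩ := TwoConv.exists_of_abs_le b v (fun i => b.coord i v * (p i / (p i + q i)))
    fun i => by
      rw [abs_mul]
      refine mul_le_of_le_one_right (abs_nonneg _) ?_
      rw [abs_of_nonneg (div_nonneg (hp i) (add_nonneg (hp i) (hq i)))]
      exact div_le_one_of_le₀ (by linarith [hq i]) (add_nonneg (hp i) (hq i))
  have key : ∀ i s, 0 ≤ s → |b.coord i v * (s / (p i + q i))| ≤ s := fun i s hs => by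
    rw [abs_mul, abs_of_nonneg (div_nonneg hs (add_nonneg (hp i) (hq i)))]
    rcases (add_nonneg (hp i) (hq i)).eq_or_lt with h | h
    · rw [← h]; simpa using hs
    · rw [mul_div_assoc', div_le_iff₀ h, mul_comm]
      exact mul_le_mul_of_nonneg_left (hpq i) hs
  have hv2 : ∀ i, b.coord i (v - v1) = b.coord i v * (q i / (p i + q i)) := fun i => by
    rw [map_sub, hv1]
    rcases eq_or_ne (p i + q i) 0 with h | h
    · simp [hz i h]
    · field_simp
      ring
  have h1 : ‖v1‖ ≤ (1 + r) * ‖x‖ ^ 2 := norm_le_of_abs_le x v1 _ (by positivity) fun i => by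
    rw [hv1]; exact key i _ (hp i)
  have h2 : ‖v - v1‖ ≤ (1 + r⁻¹) * ‖y‖ ^ 2 :=
    norm_le_of_abs_le y (v - v1) _ (by positivity) fun i => by
      rw [hv2]; exact key i _ (hq i)
  have h3 : ‖v‖ ≤ ‖v1‖ + ‖v - v1‖ := by
    have := norm_add_le v1 (v - v1)
    rwa [add_sub_cancel] at this
  have h4 : (1 + r) * ‖x‖ ^ 2 + (1 + r⁻¹) * ‖y‖ ^ 2 = (‖x‖ + ‖y‖) ^ 2 := by
    rw [hri, hr]
    field_simp
    ring
  linarith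

theorem normCore : NormedSpace.Core ℝ (TwoConvexification b) where
  norm_nonneg := norm_nonneg'
  norm_smul := norm_smul'
  norm_triangle := norm_add_le'
  norm_eq_zero_iff x := ⟨eq_zero_of_norm x, by
    rintro rfl
    have := norm_smul' (b := b) 0 0
    simpa using this⟩

noncomputable instance : NormedAddCommGroup (TwoConvexification b) :=
  NormedAddCommGroup.ofCore normCore

noncomputable instance : NormedSpace ℝ (TwoConvexification b) :=
  NormedSpace.ofCore normCore

/-- If the norm of `X` is a lattice norm for the coordinatewise order (i.e. the basis is
`1`-unconditional), then `‖x‖_(2) = ‖x²‖^{1/2}`. -/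
theorem norm_eq_sqrt
    (hb : ∀ u v : X, (∀ i, |b.coord i v| ≤ |b.coord i u|) → ‖v‖ ≤ ‖u‖)
    (x : TwoConvexification b) (u : X) (hu : ∀ i, b.coord i u = x.toSeq i ^ 2) :
    ‖x‖ = Real.sqrt ‖u‖ := by
  rw [norm_def]
  congr 1
  refine le_antisymm (csSup_le ⟨_, zero_mem_normSet x⟩ ?_) (le_csSup (bddAbove_normSet x)
    ⟨u, fun i => by rw [hu, abs_of_nonneg (sq_nonneg _)], rfl⟩)
  rintro _ ⟨v, hv, rfl⟩
  exact hb u v fun i => by rw [hu, abs_of_nonneg (sq_nonneg (x.toSeq i))]; exact hv i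

/-- In general `‖x²‖^{1/2} ≤ ‖x‖_(2) ≤ (K ‖x²‖)^{1/2}` with `K` depending only on the basis. -/
theorem exists_norm_equiv (b : UnconditionalSchauderBasis ℕ ℝ X) :
    ∃ K : ℝ, ∀ (x : TwoConvexification b) (u : X), (∀ i, b.coord i u = x.toSeq i ^ 2) →
      Real.sqrt ‖u‖ ≤ ‖x‖ ∧ ‖x‖ ≤ Real.sqrt (K * ‖u‖) := by
  obtain ⟨K, -, hK⟩ := TwoConv.exists_norm_bound b
  refine ⟨K, fun x u hu => ⟨Real.sqrt_le_sqrt (le_csSup (bddAbove_normSet x)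
    ⟨u, fun i => by rw [hu, abs_of_nonneg (sq_nonneg _)], rfl⟩),
    Real.sqrt_le_sqrt (csSup_le ⟨_, zero_mem_normSet x⟩ ?_)⟩⟩
  rintro _ ⟨v, hv, rfl⟩
  exact hK u v fun i => by rw [hu, abs_of_nonneg (sq_nonneg (x.toSeq i))]; exact hv i

end

end TwoConvexification

/-! ## Allowable families of disjointly supported vectors -/

/-! Given `E` of dimension `n`, put `k = ⌊n/2⌋` and let `V` be the vectors of `E` vanishing on the
first `k` coordinates; `V` has at least half the dimension of `E`. On `V` the norm turns out to be
equivalent, with a constant independent of `E`, to a weighted `ℓ₂`-norm `μ(f²)^{1/2}`, where `μ` is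
a positive functional on `X` with `μ ≤ ‖·‖`. This `ℓ₂`-norm is dominated by the norm on all of
`X^{(2)}`, so the orthogonal projection in `ℓ₂` pulls back to a bounded projection onto `V`
(`distEuclidean_le_and_exists_projection`).

The functional `μ` comes from separating the convex hull of the normalized squares `f²`, `f ∈ V`,
from a ball plus the negative cone. This needs the hull to stay away from `0`. The squares lie in a
space of dimension at most `(dim V)²`, so by Carathéodory each point of the hull is a convex
combination of at most `(dim V)² + 1` of them, a number of order `k²`. It therefore suffices to have
a lower `ℓ₁`-estimate for order `k²` positive vectors living beyond coordinate `k`.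

The hypothesis gives such an estimate for `k + 1` disjointly supported vectors. Convexity of the
norm removes disjointness for positive vectors (`exists_disjoint_splitting`), and then the estimate
can be iterated: sums of positive vectors are positive and still vanish on the first `k`
coordinates, so `k + 1` groups of `k + 1` vectors cost only the constant squared. -/

theorem mem_schreier_one (F : Finset ℕ) (hF : ∀ m ∈ F, F.card ≤ m) : F ∈ schreier 1 := by
  rcases F.eq_empty_or_nonempty with rfl | hne
  · exact ⟨1, le_rfl, fun _ => ∅, fun _ => Or.inl rfl, by simp, by simp, by ext; simp⟩
  have hpos : 1 ≤ F.card := hne.card_pos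
  refine ⟨F.card, hpos, fun i => {F.orderEmbOfFin rfl i}, fun i => Or.inr ⟨_, ?_, rfl⟩,
    fun i m hm => ?_, fun i j hij m hm l hl => ?_, ?_⟩
  · exact hpos.trans (hF _ (F.orderEmbOfFin_mem rfl i))
  · rw [Finset.mem_singleton.1 hm]
    exact hF _ (F.orderEmbOfFin_mem rfl i)
  · rw [Finset.mem_singleton.1 hm, Finset.mem_singleton.1 hl]
    exact (F.orderEmbOfFin rfl).strictMono hij
  · ext m
    have h : m ∈ F ↔ m ∈ Set.range (F.orderEmbOfFin rfl) := by
      rw [F.range_orderEmbOfFin rfl]; rfl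
    simp only [h, Finset.mem_biUnion, Finset.mem_univ, true_and, Finset.mem_singleton,
      Set.mem_range, eq_comm]

section

variable {X : Type*} [NormedAddCommGroup X] [NormedSpace ℝ X]

theorem coord_sum_smul_basis (b : UnconditionalSchauderBasis ℕ ℝ X) (F : Finset ℕ) (a : ℕ → ℝ)
    (j : ℕ) : b.coord j (∑ i ∈ F, a i • b i) = if j ∈ F then a j else 0 := by
  simp [map_sum, TwoConv.coord_basis_eq]

/-- Coordinates are counted from `0` and supports from `1`, so vanishing below `k` puts every
minimum at `k + 1` or later; this is why `k + 1` vectors are allowed. Zero vectors are discarded and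
the others normalized before the hypothesis is applied. -/
theorem sum_norm_le_of_disjoint_support {b : UnconditionalSchauderBasis ℕ ℝ X} {C : ℝ}
    (hX : IsAsymptoticLpDisjointWith b 1 C) {ι : Type*} [Fintype ι] {k : ℕ}
    (hι : Fintype.card ι ≤ k + 1) (F : Finset ℕ) (u : ι → X)
    (hF : ∀ i j, b.coord j (u i) ≠ 0 → j ∈ F) (hk : ∀ i, ∀ j < k, b.coord j (u i) = 0)
    (hdisj : ∀ i i', i ≠ i' → ∀ j, b.coord j (u i) = 0 ∨ b.coord j (u i') = 0) :
    ∑ i, ‖u i‖ ≤ C * ‖∑ i, u i‖ := by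
  classical
  set s : Finset ι := {i | u i ≠ 0} with hs
  have hs1 : ∑ i, ‖u i‖ = ∑ i ∈ s, ‖u i‖ := by
    rw [hs, Finset.sum_filter]
    exact Finset.sum_congr rfl fun i _ => by by_cases h : u i = 0 <;> simp [h]
  have hs2 : ∑ i, u i = ∑ i ∈ s, u i := by
    rw [hs, Finset.sum_filter]
    exact Finset.sum_congr rfl fun i _ => by by_cases h : u i = 0 <;> simp [h]
  let e : Fin s.card ≃ s := s.equivFin.symm
  have hne : ∀ i, u (e i) ≠ 0 := fun i => (Finset.mem_filter.1 (e i).2).2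
  let G : Fin s.card → Finset ℕ := fun i =>
    (F.filter fun j => b.coord j (u (e i)) ≠ 0).image Nat.succ
  have hG : ∀ i m, m ∈ G i ↔ 1 ≤ m ∧ b.coord (m - 1) (u (e i)) ≠ 0 := fun i m => by
    simp only [G, Finset.mem_image, Finset.mem_filter]
    constructor
    · rintro ⟨j, ⟨-, hj⟩, rfl⟩
      exact ⟨by omega, by simpa using hj⟩
    · rintro ⟨h1, h2⟩
      exact ⟨m - 1, ⟨hF _ _ h2, h2⟩, by omega⟩
  have hGne : ∀ i, (G i).Nonempty := fun i => by
    by_contra hcon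
    refine hne i (TwoConv.ext_coord b fun j => ?_)
    by_contra hj
    refine hcon ⟨j + 1, (hG i _).2 ⟨by omega, ?_⟩⟩
    simpa using hj
  have hall : IsAllowable 1 G := by
    refine ⟨fun i i' hii => ?_, hGne, mem_schreier_one _ fun m hm => ?_⟩
    · rw [Finset.disjoint_left]
      intro m hm hm'
      have h1 := ((hG i m).1 hm).2
      have h2 := ((hG i' m).1 hm').2
      rcases hdisj (e i) (e i') (fun h => hii (e.injective (Subtype.ext h))) (m - 1) with h | h
      · exact h1 h
      · exact h2 h
    · refine Finset.card_image_le.trans ?_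
      rw [Finset.card_univ, Fintype.card_fin]
      obtain ⟨i, -, rfl⟩ := Finset.mem_image.1 hm
      have h1 := (hG i _).1 ((G i).min'_mem (hGne i))
      have h2 : k ≤ (G i).min' (hGne i) - 1 := by
        by_contra hlt
        exact h1.2 (hk _ _ (not_le.1 hlt))
      have h3 : s.card ≤ Fintype.card ι := Finset.card_le_univ s
      omega
  have hx : ∀ i, ‖(‖u (e i)‖⁻¹ • u (e i))‖ = 1 := fun i => by
    rw [norm_smul, norm_inv, norm_norm, inv_mul_cancel₀ (norm_ne_zero_iff.2 (hne i))]
  obtain ⟨A, B, hA, hB, hAB, h⟩ := hX s.card (fun i => ‖u (e i)‖⁻¹ • u (e i)) G hx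
    (fun i => by
      ext m
      simp only [basisSupport, Set.mem_ofPred_eq, Finset.mem_coe, hG, map_smul, smul_eq_mul, ne_eq,
        mul_eq_zero, inv_eq_zero, norm_eq_zero, hne i, false_or]) hall
  rw [hs1, hs2]
  have t1 : ∑ i ∈ s, ‖u i‖ = ∑ i, ‖u (e i)‖ := by
    rw [← Finset.sum_coe_sort s, ← e.sum_comp fun i => ‖u i‖]
  have t2 : ∑ i ∈ s, u i = ∑ i, ‖u (e i)‖ • (‖u (e i)‖⁻¹ • u (e i)) := by
    rw [← Finset.sum_coe_sort s, ← e.sum_comp fun i => u i]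
    refine Finset.sum_congr rfl fun i _ => ?_
    rw [smul_smul, mul_inv_cancel₀ (norm_ne_zero_iff.2 (hne i)), one_smul]
  have h1 := (h fun i => ‖u (e i)‖).1
  rw [← t2] at h1
  simp only [abs_norm, Real.rpow_one, div_one] at h1
  rw [← t1] at h1
  rcases s.eq_empty_or_nonempty with h0 | ⟨i0, hi0⟩
  · simp [h0]
  -- Testing the upper estimate on a single normalized vector gives `B ≥ 1`, so `A * B ≤ C` forces
  -- `A ≤ C`.
  have hB1 : 1 ≤ B := by
    have h2 := (h (Pi.single (e.symm ⟨i0, hi0⟩) 1)).2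
    rw [Finset.sum_eq_single (e.symm ⟨i0, hi0⟩) (fun j _ hj => by simp [hj]) (by simp),
      Finset.sum_eq_single (e.symm ⟨i0, hi0⟩) (fun j _ hj => by simp [hj]) (by simp)] at h2
    simp only [Pi.single_eq_same, one_smul, hx] at h2
    simpa using h2
  have hAC : A ≤ C := by nlinarith
  rw [one_div, inv_mul_le_iff₀ hA] at h1
  exact h1.trans (mul_le_mul_of_nonneg_right hAC (norm_nonneg _))

/-! ## Lower `ℓ₁`-estimates for positive vectors -/

/-- Replacing positive vectors by disjointly supported ones with the same sum can only increase
the sum of their norms, for a suitable choice of the disjoint supports. -/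
theorem exists_disjoint_splitting {ι : Type*} [Fintype ι] [Nonempty ι] [DecidableEq ι] (e : ℕ → X)
    (a : ι → ℕ → ℝ) (ha : ∀ i j, 0 ≤ a i j) (F : Finset ℕ) (y : ι → X) :
    ∃ σ : ℕ → ι, ∑ i, ‖y i + ∑ j ∈ F, a i j • e j‖ ≤
      ∑ i, ‖y i + ∑ j ∈ F, (if σ j = i then ∑ l, a l j else 0) • e j‖ := by
  induction F using Finset.induction_on generalizing y with
  | empty => exact ⟨fun _ => Classical.arbitrary ι, by simp⟩
  | insert j F hj ih =>
    set w : ℝ := ∑ l, a l j with hw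
    set z : ι → X := fun i => y i + ∑ j ∈ F, a i j • e j with hz
    -- The total mass `w` at coordinate `j` is given to the vector whose norm gains most from it.
    obtain ⟨i0, -, hi0⟩ := Finset.exists_max_image (Finset.univ : Finset ι)
      (fun i => ‖z i + w • e j‖ - ‖z i‖) Finset.univ_nonempty
    set m : ℝ := ‖z i0 + w • e j‖ - ‖z i0‖ with hm
    have hw0 : 0 ≤ w := Finset.sum_nonneg fun l _ => ha l j
    have step : ∑ i, ‖z i + a i j • e j‖ ≤ ∑ i, ‖z i + (if i0 = i then w else 0) • e j‖ := by
      rcases hw0.eq_or_lt with h0 | hpos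
      · have : ∀ i, a i j = 0 := fun i =>
          (Finset.sum_eq_zero_iff_of_nonneg fun l _ => ha l j).1 h0.symm i (Finset.mem_univ i)
        simp [this, ← h0]
      -- By convexity, the fraction `a i j / w` of the mass yields at most that fraction of the
      -- maximal gain `m`; the fractions add up to `1`.
      have h1 : ∀ i, ‖z i + a i j • e j‖ ≤ ‖z i‖ + a i j / w * m := fun i => by
        have ht0 : 0 ≤ a i j / w := div_nonneg (ha i j) hw0
        have ht1 : a i j / w ≤ 1 := div_le_one_of_le₀
          (Finset.single_le_sum (fun l _ => ha l j) (Finset.mem_univ i)) hw0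
        have heq : z i + a i j • e j =
            (1 - a i j / w) • z i + (a i j / w) • (z i + w • e j) := by
          rw [smul_add (a i j / w), smul_smul, div_mul_cancel₀ _ hpos.ne', ← add_assoc, ← add_smul,
            sub_add_cancel, one_smul]
        rw [heq]
        refine (norm_add_le _ _).trans ?_
        rw [norm_smul, norm_smul, Real.norm_of_nonneg ht0, Real.norm_of_nonneg (by linarith)]
        have := mul_le_mul_of_nonneg_left (hi0 i (Finset.mem_univ i)) ht0
        linarith
      have h2 : ∀ i, ‖z i + (if i0 = i then w else 0) • e j‖ = ‖z i‖ + if i0 = i then m else 0 :=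
        fun i => by
          by_cases h : i0 = i
          · subst h; simp [hm]
          · simp [h]
      refine (Finset.sum_le_sum fun i _ => h1 i).trans_eq ?_
      simp only [h2, Finset.sum_add_distrib, Finset.sum_ite_eq, Finset.mem_univ, if_true]
      rw [← Finset.sum_mul, ← Finset.sum_div, ← hw, div_self hpos.ne', one_mul]
    obtain ⟨σ, hσ⟩ := ih fun i => y i + (if i0 = i then w else 0) • e j
    refine ⟨Function.update σ j i0, ?_⟩
    calc ∑ i, ‖y i + ∑ j ∈ insert j F, a i j • e j‖ = ∑ i, ‖z i + a i j • e j‖ := by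
          refine Finset.sum_congr rfl fun i _ => ?_
          rw [Finset.sum_insert hj, hz, add_right_comm, add_assoc]
      _ ≤ ∑ i, ‖z i + (if i0 = i then w else 0) • e j‖ := step
      _ = ∑ i, ‖y i + (if i0 = i then w else 0) • e j + ∑ j ∈ F, a i j • e j‖ := by
          refine Finset.sum_congr rfl fun i _ => ?_
          rw [hz, add_right_comm]
      _ ≤ _ := hσ
      _ = _ := by
          refine Finset.sum_congr rfl fun i _ => ?_
          rw [Finset.sum_insert hj, Function.update_self, add_assoc]
          congr 3
          refine Finset.sum_congr rfl fun l hl => ?_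
          rw [Function.update_of_ne (ne_of_mem_of_not_mem hl hj)]

/-- The lower `ℓ₁`-estimate with constant `D` for families, indexed by `ι`, of positive vectors
which vanish on the first `k` coordinates. -/
def HasLowerEstimate (b : UnconditionalSchauderBasis ℕ ℝ X) (k : ℕ) (ι : Type*) [Fintype ι]
    (D : ℝ) : Prop :=
  ∀ u : ι → X, (∀ i j, 0 ≤ b.coord j (u i)) → (∀ i, ∀ j < k, b.coord j (u i) = 0) →
    ∑ i, ‖u i‖ ≤ D * ‖∑ i, u i‖

variable {b : UnconditionalSchauderBasis ℕ ℝ X} {k : ℕ}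

/-- Truncate to a finite set of coordinates, replace the truncations by disjointly supported vectors
with the same sum and no smaller total norm, apply the disjoint estimate, and pass to the limit. -/
theorem hasLowerEstimate_of_card_le {C : ℝ} (hX : IsAsymptoticLpDisjointWith b 1 C)
    {ι : Type*} [Fintype ι] (hι : Fintype.card ι ≤ k + 1) : HasLowerEstimate b k ι C := by
  classical
  intro u hu hk
  rcases isEmpty_or_nonempty ι with _ | _
  · simp
  have hlim : ∀ v : X, Filter.Tendsto (fun F : Finset ℕ => ∑ j ∈ F, b.coord j v • b j)
      Filter.atTop (nhds v) := fun v => b.expansion v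
  refine le_of_tendsto_of_tendsto (tendsto_finsetSum _ fun i _ => (hlim (u i)).norm)
    ((hlim (∑ i, u i)).norm.const_mul C) (Filter.Eventually.of_forall fun F => ?_)
  obtain ⟨σ, hσ⟩ := exists_disjoint_splitting b (fun i j => b.coord j (u i)) hu F 0
  simp only [Pi.zero_apply, zero_add] at hσ
  refine hσ.trans ?_
  have key := sum_norm_le_of_disjoint_support hX hι F
    (fun i => ∑ j ∈ F, (if σ j = i then ∑ l, b.coord j (u l) else 0) • b j)
    (fun i j h => by
      by_contra hj
      exact h (by rw [coord_sum_smul_basis, if_neg hj]))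
    (fun i j hj => by
      rw [coord_sum_smul_basis]
      simp [hk _ j hj])
    (fun i i' hii j => by
      rw [coord_sum_smul_basis, coord_sum_smul_basis]
      by_cases h : σ j = i
      · right
        have : σ j ≠ i' := fun h' => hii (h.symm.trans h')
        simp [this]
      · left
        simp [h])
  refine key.trans_eq ?_
  congr 2
  rw [Finset.sum_comm]
  refine Finset.sum_congr rfl fun j _ => ?_
  rw [← Finset.sum_smul]
  simp [map_sum]

/-! ### From `k + 1` to quadratically many positive vectors -/

theorem HasLowerEstimate.prod {ι κ : Type*} [Fintype ι] [Fintype κ] {D D' : ℝ} (hD' : 0 ≤ D')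
    (h : HasLowerEstimate b k ι D) (h' : HasLowerEstimate b k κ D') :
    HasLowerEstimate b k (ι × κ) (D' * D) := by
  intro u hu hk
  rw [Fintype.sum_prod_type, Fintype.sum_prod_type]
  calc ∑ i, ∑ j, ‖u (i, j)‖ ≤ ∑ i, D' * ‖∑ j, u (i, j)‖ :=
        Finset.sum_le_sum fun i _ => h' _ (fun j => hu _) (fun j => hk _)
    _ = D' * ∑ i, ‖∑ j, u (i, j)‖ := (Finset.mul_sum _ _ _).symm
    _ ≤ D' * (D * ‖∑ i, ∑ j, u (i, j)‖) := by
        refine mul_le_mul_of_nonneg_left (h _ (fun i j => ?_) fun i j hj => ?_) hD'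
        · rw [map_sum]
          exact Finset.sum_nonneg fun l _ => hu _ _
        · rw [map_sum]
          exact Finset.sum_eq_zero fun l _ => hk _ j hj
    _ = _ := (mul_assoc _ _ _).symm

theorem HasLowerEstimate.of_injective {ι κ : Type*} [Fintype ι] [Fintype κ] {D : ℝ}
    (h : HasLowerEstimate b k κ D) (f : ι → κ) (hf : Function.Injective f) :
    HasLowerEstimate b k ι D := by
  classical
  intro u hu hk
  have hz : ∀ j, j ∉ Set.range f → Function.extend f u 0 j = 0 := fun j hj =>
    Function.extend_apply' _ _ _ hj
  have hex : ∀ P : X → Prop, P 0 → (∀ i, P (u i)) → ∀ j, P (Function.extend f u 0 j) :=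
    fun P h0 hP j => by
      by_cases hj : j ∈ Set.range f
      · obtain ⟨i, rfl⟩ := hj
        rw [hf.extend_apply]
        exact hP i
      · rw [hz j hj]
        exact h0
  have h1 := h (Function.extend f u 0)
    (hex (fun v => ∀ j, 0 ≤ b.coord j v) (by simp) hu)
    (hex (fun v => ∀ j < k, b.coord j v = 0) (by simp) hk)
  rwa [← Fintype.sum_of_injective f hf (fun i => ‖u i‖) _ (fun j hj => by rw [hz j hj, norm_zero])
      fun i => by rw [hf.extend_apply],
    ← Fintype.sum_of_injective f hf u _ hz fun i => (hf.extend_apply u 0 i).symm] at h1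

/-- Each positive summand is dominated coordinatewise by the sum. The constant grows with `r`, so
this serves only for a fixed number of blocks. -/
theorem HasLowerEstimate.of_norm_bound {K : ℝ}
    (hK : ∀ u v : X, (∀ i, |b.coord i v| ≤ |b.coord i u|) → ‖v‖ ≤ K * ‖u‖) (r : ℕ) :
    HasLowerEstimate b k (Fin r) (r * K) := by
  intro u hu _
  have h : ∀ i, ‖u i‖ ≤ K * ‖∑ i, u i‖ := fun i => hK _ _ fun j => by
    rw [map_sum, abs_of_nonneg (hu i j), abs_of_nonneg (Finset.sum_nonneg fun l _ => hu l j)]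
    exact Finset.single_le_sum (f := fun l => b.coord j (u l)) (fun l _ => hu l j)
      (Finset.mem_univ i)
  refine (Finset.sum_le_sum fun i _ => h i).trans_eq ?_
  simp [mul_assoc]

/-- An asymptotic `ℓ₁` space has a lower `ℓ₁`-estimate for quadratically many positive vectors. -/
theorem hasLowerEstimate_of_card_le_sq {C K : ℝ} (hC : 0 < C)
    (hX : IsAsymptoticLpDisjointWith b 1 C)
    (hK : ∀ u v : X, (∀ i, |b.coord i v| ≤ |b.coord i u|) → ‖v‖ ≤ K * ‖u‖) (r : ℕ)
    {ι : Type*} [Fintype ι] (hι : Fintype.card ι ≤ r * ((k + 1) * (k + 1))) :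
    HasLowerEstimate b k ι (C * C * (r * K)) := by
  have h1 : HasLowerEstimate b k (Fin (k + 1)) C := hasLowerEstimate_of_card_le hX (by simp)
  have h2 := (HasLowerEstimate.of_norm_bound hK r).prod (mul_nonneg hC.le hC.le)
    (h1.prod hC.le h1)
  have h3 : Nonempty (ι ↪ Fin r × Fin (k + 1) × Fin (k + 1)) := by
    rw [Function.Embedding.nonempty_iff_card_le]
    simpa using hι
  exact h2.of_injective _ h3.some.injective

end

section

variable {X : Type*} [NormedAddCommGroup X] [NormedSpace ℝ X]
  {b : UnconditionalSchauderBasis ℕ ℝ X}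

/-! ## A positive functional which is large on a set of positive vectors -/

open scoped Pointwise in
-- Hahn–Banach separation of the convex hull of `S` from a small ball plus the negative cone `N`:
-- the ball controls the norm of the functional, and the cone makes it positive.
theorem exists_positive_functional {K D : ℝ} (hK0 : 0 ≤ K) (hD : 0 < D)
    (hK : ∀ u v : X, (∀ i, |b.coord i v| ≤ |b.coord i u|) → ‖v‖ ≤ K * ‖u‖) (S : Set X)
    (hpos : ∀ z ∈ convexHull ℝ S, ∀ j, 0 ≤ b.coord j z)
    (hS : ∀ z ∈ convexHull ℝ S, 1 ≤ D * ‖z‖) :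
    ∃ μ : StrongDual ℝ X, (∀ x, (∀ j, 0 ≤ b.coord j x) → 0 ≤ μ x) ∧ (∀ x, μ x ≤ ‖x‖) ∧
      ∀ z ∈ S, (D * (K + 1))⁻¹ ≤ μ z := by
  set ρ : ℝ := (D * (K + 1))⁻¹ with hρ
  have hρ0 : 0 < ρ := by positivity
  let N : Set X := {p | ∀ j, b.coord j p ≤ 0}
  have hN : Convex ℝ N := by
    intro x hx y hy s t hs ht _ j
    simp only [map_add, map_smul, smul_eq_mul]
    have h1 := mul_nonpos_of_nonneg_of_nonpos hs (hx j)
    have h2 := mul_nonpos_of_nonneg_of_nonpos ht (hy j)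
    linarith
  have hdisj : Disjoint (Metric.ball (0 : X) ρ + N) (convexHull ℝ S) := by
    rw [Set.disjoint_left]
    rintro _ ⟨w, hw, p, hp, rfl⟩ hz
    -- A common point would satisfy `0 ≤ w + p ≤ w`, hence have norm too small for the hull.
    have h1 : ‖w + p‖ ≤ K * ‖w‖ := hK _ _ fun j => by
      have h2 := hpos _ hz j
      simp only [map_add] at h2 ⊢
      rw [abs_of_nonneg h2]
      have := hp j
      exact le_trans (by linarith) (le_abs_self _)
    have h2 := hS _ hz
    rw [mem_ball_zero_iff] at hw
    have h3 : D * ‖w + p‖ ≤ D * ((K + 1) * ‖w‖) :=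
      mul_le_mul_of_nonneg_left (h1.trans (by nlinarith [norm_nonneg w])) hD.le
    have h4 : D * ((K + 1) * ‖w‖) < D * ((K + 1) * ρ) := by gcongr
    have h5 : D * ((K + 1) * ρ) = 1 := by rw [hρ]; field_simp
    linarith
  obtain ⟨φ, a, hφ, ha⟩ := geometric_hahn_banach_open ((convex_ball 0 ρ).add hN)
    (Metric.isOpen_ball.add_right) (convex_convexHull ℝ S) hdisj
  have hball : ∀ x, ‖x‖ < ρ → φ x < a := fun x hx =>
    hφ x ⟨x, mem_ball_zero_iff.2 hx, 0, fun j => by simp, add_zero x⟩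
  have ha0 : 0 < a := by simpa using hball 0 (by simpa using hρ0)
  -- Since `φ < a` on the ball of radius `ρ` and `φ ≥ a` on `S`, this scaling gives `μ ≤ ‖·‖`
  -- everywhere and `μ ≥ ρ` on `S`.
  refine ⟨(ρ / a) • φ, fun x hx => ?_, fun x => ?_, fun z hz => ?_⟩
  · have h : 0 ≤ φ x := by
      by_contra! hneg
      -- If `φ x < 0`, this negative multiple of `x` lies in `N` and `φ` takes the value `a` there,
      -- against strict separation.
      have := hφ ((a / φ x) • x) ⟨0, by simpa using hρ0, (a / φ x) • x, fun j => by
        rw [map_smul, smul_eq_mul]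
        exact mul_nonpos_of_nonpos_of_nonneg (div_nonpos_of_nonneg_of_nonpos ha0.le hneg.le)
          (hx j), zero_add _⟩
      rw [map_smul, smul_eq_mul, div_mul_cancel₀ _ hneg.ne] at this
      exact lt_irrefl _ this
    simp only [smul_apply, smul_eq_mul]
    positivity
  · simp only [smul_apply, smul_eq_mul]
    refine le_of_forall_gt_imp_ge_of_dense fun t ht => ?_
    have ht0 : 0 < t := (norm_nonneg x).trans_lt ht
    have h1 := hball ((ρ / t) • x) (by
      rw [norm_smul, Real.norm_of_nonneg (by positivity), div_mul_eq_mul_div, div_lt_iff₀ ht0]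
      gcongr)
    rw [map_smul, smul_eq_mul, div_mul_eq_mul_div, div_lt_iff₀ ht0] at h1
    rw [div_mul_eq_mul_div, div_le_iff₀ ha0]
    linarith
  · simp only [smul_apply, smul_eq_mul]
    have := ha z (subset_convexHull ℝ S hz)
    rw [div_mul_eq_mul_div, le_div_iff₀ ha0]
    exact mul_le_mul_of_nonneg_left this hρ0.le

end

namespace TwoConvexification

variable {X : Type*} [NormedAddCommGroup X] [NormedSpace ℝ X] [CompleteSpace X]
  {b : UnconditionalSchauderBasis ℕ ℝ X}

/-! ## Products of elements of the 2-convexification -/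

theorem exists_mul (f g : TwoConvexification b) :
    ∃ u : X, ∀ j, b.coord j u = f.toSeq j * g.toSeq j := by
  obtain ⟨u, hu⟩ := f.toSeq_mem
  obtain ⟨v, hv⟩ := g.toSeq_mem
  refine TwoConv.exists_of_abs_le b (u + v) _ fun j => ?_
  rw [map_add, hu, hv]
  refine le_trans ?_ (le_abs_self _)
  rw [abs_le]
  constructor <;> nlinarith [sq_nonneg (f.toSeq j + g.toSeq j), sq_nonneg (f.toSeq j - g.toSeq j)]

/-- The pointwise product `X^{(2)} × X^{(2)} → X`. -/
noncomputable def mul (f g : TwoConvexification b) : X := (exists_mul f g).choose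

@[simp] theorem coord_mul (f g : TwoConvexification b) (j : ℕ) :
    b.coord j (mul f g) = f.toSeq j * g.toSeq j := (exists_mul f g).choose_spec j

/-- The pointwise product as a bilinear map. -/
noncomputable def mulBilin (b : UnconditionalSchauderBasis ℕ ℝ X) :
    TwoConvexification b →ₗ[ℝ] TwoConvexification b →ₗ[ℝ] X :=
  LinearMap.mk₂ ℝ mul
    (fun f f' g => TwoConv.ext_coord b fun j => by simp [add_mul])
    (fun c f g => TwoConv.ext_coord b fun j => by simp [mul_assoc])
    (fun f g g' => TwoConv.ext_coord b fun j => by simp [mul_add])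
    (fun c f g => TwoConv.ext_coord b fun j => by simp [mul_left_comm])

theorem finrank_map₂_mulBilin_le (V : Submodule ℝ (TwoConvexification b)) [FiniteDimensional ℝ V] :
    Module.finrank ℝ (Submodule.map₂ (mulBilin b) V V) ≤
      Module.finrank ℝ V * Module.finrank ℝ V := by
  rw [TensorProduct.map₂_eq_range_lift_comp_mapIncl, ← Module.finrank_tensorProduct]
  exact LinearMap.finrank_range_le _

theorem norm_mul_self_le (f : TwoConvexification b) : ‖mul f f‖ ≤ ‖f‖ ^ 2 := by
  have := norm_le_of_abs_le f (mul f f) 1 zero_le_one fun j => by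
    rw [coord_mul, one_mul, ← sq, abs_of_nonneg (sq_nonneg _)]
  rwa [one_mul] at this

theorem sq_norm_le_mul_norm {K : ℝ}
    (hK : ∀ u v : X, (∀ i, |b.coord i v| ≤ |b.coord i u|) → ‖v‖ ≤ K * ‖u‖)
    (f : TwoConvexification b) : ‖f‖ ^ 2 ≤ K * ‖mul f f‖ :=
  sq_norm_le _ _ fun v hv => hK _ _ fun j => by
    rw [coord_mul, ← sq, abs_of_nonneg (sq_nonneg (f.toSeq j))]
    exact hv j

/-! ## A weighted `ℓ₂`-norm on a finite-dimensional subspace -/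

theorem one_le_mul_norm_of_mem_convexHull {k : ℕ} {D : ℝ}
    (V : Submodule ℝ (TwoConvexification b)) [FiniteDimensional ℝ V]
    (hV : ∀ f ∈ V, ∀ j < k, f.toSeq j = 0)
    (hD : ∀ r : ℕ, r ≤ Module.finrank ℝ V * Module.finrank ℝ V + 1 → HasLowerEstimate b k (Fin r) D)
    {z : X} (hz : z ∈ convexHull ℝ {u : X | ∃ f ∈ V, u = mul f f ∧ ‖u‖ = 1}) :
    1 ≤ D * ‖z‖ := by
  -- Carathéodory: the points are affinely independent and lie in the span of products of elements
  -- of `V`, which bounds their number by `(dim V)² + 1`.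
  obtain ⟨ι, _, u, w, hu, hind, hw, hw1, rfl⟩ := eq_pos_convex_span_of_mem_convexHull hz
  have hW : vectorSpan ℝ (Set.range u) ≤ Submodule.map₂ (mulBilin b) V V := by
    rw [vectorSpan_def, Submodule.span_le]
    rintro _ ⟨x, hx, y, hy, rfl⟩
    have h : ∀ x ∈ Set.range u, x ∈ Submodule.map₂ (mulBilin b) V V := fun x hx => by
      obtain ⟨f, hf, rfl, -⟩ := hu hx
      exact Submodule.apply_mem_map₂ (mulBilin b) hf hf
    exact Submodule.sub_mem _ (h x hx) (h y hy)
  have : FiniteDimensional ℝ (Submodule.map₂ (mulBilin b) V V) := by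
    rw [TensorProduct.map₂_eq_range_lift_comp_mapIncl]
    infer_instance
  have hcard : Fintype.card ι ≤ Module.finrank ℝ V * Module.finrank ℝ V + 1 :=
    hind.card_le_finrank_succ.trans (Nat.succ_le_succ
      ((Submodule.finrank_mono hW).trans (finrank_map₂_mulBilin_le V)))
  have hu' : ∀ i, ∃ f ∈ V, u i = mul f f ∧ ‖u i‖ = 1 := fun i => hu ⟨i, rfl⟩
  have key := (hD _ hcard).of_injective (Fintype.equivFin ι) (Fintype.equivFin ι).injective
    (fun i => w i • u i)
    (fun i j => by
      obtain ⟨f, -, hf, -⟩ := hu' i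
      rw [map_smul, hf, coord_mul]
      exact mul_nonneg (hw i).le (mul_self_nonneg _))
    (fun i j hj => by
      obtain ⟨f, hfV, hf, -⟩ := hu' i
      rw [map_smul, hf, coord_mul, hV f hfV j hj, zero_mul, smul_zero])
  have hn : ∀ i, ‖w i • u i‖ = w i := fun i => by
    obtain ⟨f, -, -, hf⟩ := hu' i
    rw [norm_smul, hf, mul_one, Real.norm_of_nonneg (hw i).le]
  simpa only [hn, hw1] using key

/-- The separating functional is bounded below on normalized squares, and homogeneity extends this
to all of `V`. The extra factor `K` compares `‖f‖ ^ 2` with `‖mul f f‖`, as the norm of `X` need not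
be a lattice norm. -/
theorem exists_weight {K D : ℝ} {k : ℕ} (hK0 : 0 ≤ K) (hD0 : 0 < D)
    (hK : ∀ u v : X, (∀ i, |b.coord i v| ≤ |b.coord i u|) → ‖v‖ ≤ K * ‖u‖)
    (V : Submodule ℝ (TwoConvexification b)) [FiniteDimensional ℝ V]
    (hV : ∀ f ∈ V, ∀ j < k, f.toSeq j = 0)
    (hD : ∀ r : ℕ, r ≤ Module.finrank ℝ V * Module.finrank ℝ V + 1 →
      HasLowerEstimate b k (Fin r) D) :
    ∃ μ : StrongDual ℝ X, (∀ x, (∀ j, 0 ≤ b.coord j x) → 0 ≤ μ x) ∧ (∀ x, μ x ≤ ‖x‖) ∧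
      ∀ f ∈ V, ‖f‖ ^ 2 ≤ K * (D * (K + 1)) * μ (mul f f) := by
  obtain ⟨μ, h1, h2, h3⟩ := exists_positive_functional hK0 hD0 hK
    {u : X | ∃ f ∈ V, u = mul f f ∧ ‖u‖ = 1}
    (fun z hz j => by
      have : convexHull ℝ {u : X | ∃ f ∈ V, u = mul f f ∧ ‖u‖ = 1} ⊆
          {z | 0 ≤ b.coord j z} := by
        refine convexHull_min ?_ (convex_halfSpace_ge (b.coord j).isLinear 0)
        rintro _ ⟨f, -, rfl, -⟩
        simpa using mul_self_nonneg _
      exact this hz)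
    (fun z hz => one_le_mul_norm_of_mem_convexHull V hV hD hz)
  refine ⟨μ, h1, h2, fun f hf => (sq_norm_le_mul_norm hK f).trans ?_⟩
  rw [mul_assoc]
  refine mul_le_mul_of_nonneg_left ?_ hK0
  rcases eq_or_ne (mul f f) 0 with h0 | h0
  · simp [h0]
  have hn : 0 < ‖mul f f‖ := norm_pos_iff.2 h0
  have hs : mul ((√‖mul f f‖)⁻¹ • f) ((√‖mul f f‖)⁻¹ • f) = ‖mul f f‖⁻¹ • mul f f := by
    refine TwoConv.ext_coord b fun j => ?_
    rw [map_smul, coord_mul, coord_mul, toSeq_smul, smul_eq_mul, mul_mul_mul_comm, ← mul_inv,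
      Real.mul_self_sqrt hn.le]
  have h4 := h3 _ ⟨_, V.smul_mem (√‖mul f f‖)⁻¹ hf, rfl, by
    rw [hs, norm_smul, norm_inv, norm_norm, inv_mul_cancel₀ hn.ne']⟩
  rw [hs, map_smul, smul_eq_mul, ← div_eq_inv_mul, le_div_iff₀ hn] at h4
  have h5 : 0 < D * (K + 1) := by positivity
  rwa [inv_mul_le_iff₀ h5] at h4

end TwoConvexification

/-! ## Subspaces embedding well into a Hilbert space -/

/-- The projection is `(T|V)⁻¹ ∘ Q ∘ T`, with `Q` the orthogonal projection onto `T V`. It is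
defined on all of `L` because `T` is a contraction there, not only on `V`. -/
theorem distEuclidean_le_and_exists_projection {L H : Type*} [NormedAddCommGroup L]
    [NormedSpace ℝ L] [NormedAddCommGroup H] [InnerProductSpace ℝ H] (T : L →ₗ[ℝ] H)
    (hT : ∀ f, ‖T f‖ ≤ ‖f‖) (V : Submodule ℝ L) [FiniteDimensional ℝ V] {K : ℝ} (hK : 0 ≤ K)
    (hV : ∀ f ∈ V, ‖f‖ ≤ K * ‖T f‖) :
    distEuclidean V ≤ K ∧ ∃ P : L →L[ℝ] V, (∀ f : V, P (f : L) = f) ∧ ‖P‖ ≤ K := by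
  have hinj : Function.Injective (T.domRestrict V) := by
    rw [injective_iff_map_eq_zero]
    intro f hf
    have h1 := hV f f.2
    rw [LinearMap.domRestrict_apply] at hf
    rw [hf, norm_zero, mul_zero] at h1
    exact Subtype.ext (norm_le_zero_iff.1 h1)
  let e := LinearEquiv.ofInjective (T.domRestrict V) hinj
  have he : ∀ f : V, ‖e f‖ = ‖T f‖ := fun f => rfl
  have hes : ∀ w, ‖e.symm w‖ ≤ K * ‖w‖ := fun w => by
    have h1 := hV _ (e.symm w).2
    rwa [← he, e.apply_symm_apply] at h1
  constructor
  · let g := ((stdOrthonormalBasis ℝ (T.domRestrict V).range).reindex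
      (finCongr e.finrank_eq.symm)).repr
    let S := (e.trans g.toLinearEquiv).toContinuousLinearEquiv
    have h1 : ‖(S : V →L[ℝ] EuclideanSpace ℝ (Fin (Module.finrank ℝ V)))‖ ≤ 1 :=
      ContinuousLinearMap.opNorm_le_bound _ zero_le_one fun f => by
        have : ‖S f‖ = ‖T f‖ := (g.norm_map (e f)).trans (he f)
        rw [one_mul]
        exact this.trans_le (hT f)
    have h2 : ‖(S.symm : EuclideanSpace ℝ (Fin (Module.finrank ℝ V)) →L[ℝ] V)‖ ≤ K :=
      ContinuousLinearMap.opNorm_le_bound _ hK fun x => by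
        have : ‖e.symm (g.symm x)‖ ≤ K * ‖g.symm x‖ := hes _
        rwa [g.symm.norm_map] at this
    have h3 : distEuclidean V ≤ ‖(S : V →L[ℝ] EuclideanSpace ℝ (Fin (Module.finrank ℝ V)))‖ *
        ‖(S.symm : EuclideanSpace ℝ (Fin (Module.finrank ℝ V)) →L[ℝ] V)‖ :=
      csInf_le ⟨0, by rintro _ ⟨R, rfl⟩; positivity⟩ ⟨S, rfl⟩
    exact h3.trans ((mul_le_mul h1 h2 (ContinuousLinearMap.opNorm_nonneg _)
      zero_le_one).trans_eq (one_mul K))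
  · let P : L →ₗ[ℝ] V := e.symm.toLinearMap ∘ₗ
      (T.domRestrict V).range.orthogonalProjectionOnto.toLinearMap ∘ₗ T
    refine ⟨P.mkContinuous K fun f => ?_, fun f => ?_, P.mkContinuous_norm_le hK _⟩
    · refine (hes _).trans (mul_le_mul_of_nonneg_left (le_trans ?_ (hT f)) hK)
      exact ((T.domRestrict V).range.orthogonalProjectionOnto.le_of_opNorm_le
        (Submodule.orthogonalProjectionOnto_norm_le _) (T f)).trans_eq (one_mul _)
    · have h1 : T (f : L) = (e f : H) := rfl
      change e.symm ((T.domRestrict V).range.orthogonalProjectionOnto (T (f : L))) = f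
      rw [h1, Submodule.orthogonalProjectionOnto_mem_subspace_eq_self, e.symm_apply_apply]

namespace TwoConvexification

variable {X : Type*} [NormedAddCommGroup X] [NormedSpace ℝ X] [CompleteSpace X]
  {b : UnconditionalSchauderBasis ℕ ℝ X}

/-- Expanding `f²` in the basis gives `μ(f²) = ∑ μ(b j) f_j²` with nonnegative weights, so `T`
multiplies the coordinates by `√(μ (b j))`. -/
theorem exists_map_lp (μ : StrongDual ℝ X) (hμ : ∀ x, (∀ j, 0 ≤ b.coord j x) → 0 ≤ μ x) :
    ∃ T : TwoConvexification b →ₗ[ℝ] lp (fun _ : ℕ => ℝ) 2, ∀ f, ‖T f‖ ^ 2 = μ (mul f f) := by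
  have hb : ∀ j, 0 ≤ μ (b j) := fun j => hμ _ fun i => by
    rw [TwoConv.coord_basis_eq]
    split_ifs <;> norm_num
  have hp : ∀ t : ℝ, t ^ (2 : ENNReal).toReal = t ^ 2 := fun t => by simp
  have hsum : ∀ f : TwoConvexification b,
      HasSum (fun j => ‖√(μ (b j)) * f.toSeq j‖ ^ (2 : ENNReal).toReal) (μ (mul f f)) := fun f => by
    have h := μ.hasSum (b.expansion (mul f f))
    have heq : (fun j => ‖√(μ (b j)) * f.toSeq j‖ ^ (2 : ENNReal).toReal) =
        fun j => μ (b.coord j (mul f f) • b j) := funext fun j => by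
      rw [hp, Real.norm_eq_abs, sq_abs, mul_pow, Real.sq_sqrt (hb j), map_smul, coord_mul,
        smul_eq_mul]
      ring
    rwa [heq]
  refine ⟨{ toFun := fun f => ⟨fun j => √(μ (b j)) * f.toSeq j,
              (memℓp_gen_iff (by norm_num)).2 (hsum f).summable⟩
            map_add' := fun f g => ?_
            map_smul' := fun c f => ?_ }, fun f => ?_⟩
  · exact lp.ext (funext fun j => mul_add _ _ _)
  · exact lp.ext (funext fun j => mul_left_comm _ _ _)
  · exact (hp _).symm.trans ((lp.norm_rpow_eq_tsum (by norm_num) _).trans (hsum f).tsum_eq)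

/-! ## Completeness -/

/-- Polarization: for unit vectors, `fg = ((f + g)² - (f - g)²) / 4` has norm at most `(4 + 4) / 4 =
2`. -/
theorem norm_mul_le (f g : TwoConvexification b) : ‖mul f g‖ ≤ 2 * ‖f‖ * ‖g‖ := by
  have h : ∀ f g : TwoConvexification b, ‖f‖ = 1 → ‖g‖ = 1 → ‖mul f g‖ ≤ 2 := fun f g hf hg => by
    have h1 : mul f g = (1 / 4 : ℝ) • (mul (f + g) (f + g) - mul (f - g) (f - g)) := by
      refine TwoConv.ext_coord b fun j => ?_
      have h2 : (f - g).toSeq j = f.toSeq j - g.toSeq j := rfl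
      simp only [map_smul, map_sub, coord_mul, toSeq_add, h2, smul_eq_mul]
      ring
    have h2 := (norm_mul_self_le (f + g)).trans
      (pow_le_pow_left₀ (norm_nonneg _) (norm_add_le f g) 2)
    have h3 := (norm_mul_self_le (f - g)).trans
      (pow_le_pow_left₀ (norm_nonneg _) (norm_sub_le f g) 2)
    have h4 := norm_sub_le (mul (f + g) (f + g)) (mul (f - g) (f - g))
    rw [h1, norm_smul, Real.norm_of_nonneg (by norm_num)]
    rw [hf, hg] at h2 h3
    linarith
  rcases eq_or_ne f 0 with rfl | hf
  · have : mul (0 : TwoConvexification b) g = 0 := (mulBilin b).map_zero₂ g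
    simp [this]
  rcases eq_or_ne g 0 with rfl | hg
  · have : mul f (0 : TwoConvexification b) = 0 := (mulBilin b f).map_zero
    simp [this]
  have hf0 := norm_pos_iff.2 hf
  have hg0 := norm_pos_iff.2 hg
  have h1 := h (‖f‖⁻¹ • f) (‖g‖⁻¹ • g)
    (by rw [norm_smul, norm_inv, norm_norm, inv_mul_cancel₀ hf0.ne'])
    (by rw [norm_smul, norm_inv, norm_norm, inv_mul_cancel₀ hg0.ne'])
  have h2 : mul (‖f‖⁻¹ • f) (‖g‖⁻¹ • g) = (‖f‖ * ‖g‖)⁻¹ • mul f g := by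
    refine TwoConv.ext_coord b fun j => ?_
    simp only [map_smul, coord_mul, toSeq_smul, smul_eq_mul, mul_inv]
    ring
  rw [h2, norm_smul, norm_inv, norm_mul, norm_norm, norm_norm,
    inv_mul_le_iff₀ (mul_pos hf0 hg0)] at h1
  linarith

theorem abs_toSeq_le (f : TwoConvexification b) (j : ℕ) :
    |f.toSeq j| ≤ √‖b.coord j‖ * ‖f‖ := by
  refine abs_le_of_sq_le_sq ?_ (by positivity)
  rw [mul_pow, Real.sq_sqrt (norm_nonneg _)]
  have h1 : f.toSeq j ^ 2 = b.coord j (mul f f) := by rw [coord_mul, sq]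
  rw [h1]
  refine (le_abs_self _).trans (((b.coord j).le_opNorm _).trans ?_)
  exact mul_le_mul_of_nonneg_left (norm_mul_self_le f) (norm_nonneg _)

theorem cauchySeq_mul_self {x : ℕ → TwoConvexification b} (hx : CauchySeq x) :
    CauchySeq fun n => mul (x n) (x n) := by
  obtain ⟨R, hR0, hR⟩ := cauchySeq_bdd hx
  obtain ⟨β, hβ0, hβ, hβ'⟩ := cauchySeq_iff_le_tendsto_0.1 hx
  set M : ℝ := ‖x 0‖ + R with hM
  have hM0 : 0 ≤ M := by positivity
  have hxM : ∀ n, ‖x n‖ ≤ M := fun n => by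
    have h1 := (hR n 0).le
    rw [dist_eq_norm] at h1
    have h2 := norm_add_le (x 0) (x n - x 0)
    rw [add_sub_cancel] at h2
    linarith
  refine cauchySeq_iff_le_tendsto_0.2 ⟨fun N => 4 * M * β N, fun N => ?_, fun n m N hn hm => ?_, ?_⟩
  · have := hβ0 N
    positivity
  · have h1 : mul (x n) (x n) - mul (x m) (x m) = mul (x n + x m) (x n - x m) := by
      refine TwoConv.ext_coord b fun j => ?_
      have h2 : (x n - x m).toSeq j = (x n).toSeq j - (x m).toSeq j := rfl
      simp only [map_sub, coord_mul, toSeq_add, h2]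
      ring
    have h2 := hβ n m N hn hm
    rw [dist_eq_norm] at h2 ⊢
    rw [h1]
    refine (norm_mul_le _ _).trans ?_
    have h3 : ‖x n + x m‖ ≤ 2 * M := (norm_add_le _ _).trans (by linarith [hxM n, hxM m])
    calc 2 * ‖x n + x m‖ * ‖x n - x m‖ ≤ 2 * (2 * M) * β N := by gcongr
      _ = _ := by ring
  · simpa using hβ'.const_mul (4 * M)

/-- The squares of a Cauchy sequence converge in `X` to the square of the coordinatewise limit. -/
theorem exists_tendsto_mul_self {x : ℕ → TwoConvexification b} (hx : CauchySeq x) {ξ : ℕ → ℝ}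
    (hξ : ∀ j, Filter.Tendsto (fun n => (x n).toSeq j) Filter.atTop (nhds (ξ j))) :
    ∃ u : X, Filter.Tendsto (fun n => mul (x n) (x n)) Filter.atTop (nhds u) ∧
      ∀ j, b.coord j u = ξ j ^ 2 := by
  obtain ⟨u, hu⟩ := cauchySeq_tendsto_of_complete (cauchySeq_mul_self hx)
  refine ⟨u, hu, fun j => ?_⟩
  have h1 := ((b.coord j).continuous.tendsto u).comp hu
  refine tendsto_nhds_unique h1 (((hξ j).pow 2).congr fun n => ?_)
  rw [Function.comp_apply, coord_mul, sq]

/-- The coordinatewise limit belongs to the space because the squares converge in `X`. Convergence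
in norm follows by applying the same fact to `x n - x m` with `n` fixed, whose squares converge to
`(x n - z)²`. -/
theorem completeSpace (b : UnconditionalSchauderBasis ℕ ℝ X) :
    CompleteSpace (TwoConvexification b) := by
  obtain ⟨K, hK0, hK⟩ := TwoConv.exists_norm_bound b
  refine Metric.complete_of_cauchySeq_tendsto fun x hx => ?_
  have hcoord : ∀ j, ∃ t, Filter.Tendsto (fun n => (x n).toSeq j) Filter.atTop (nhds t) :=
    fun j => by
      let φ : TwoConvexification b →ₗ[ℝ] ℝ :=
        { toFun := fun f => f.toSeq j, map_add' := fun _ _ => rfl, map_smul' := fun _ _ => rfl }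
      exact cauchySeq_tendsto_of_complete
        (hx.map (φ.mkContinuous _ fun f => abs_toSeq_le f j).uniformContinuous)
  choose ξ hξ using hcoord
  obtain ⟨u, -, hu⟩ := exists_tendsto_mul_self hx hξ
  let z : TwoConvexification b := (⟨ξ, u, hu⟩ : ↥(TwoConv.carrier b))
  obtain ⟨β, hβ0, hβ, hβ'⟩ := cauchySeq_iff_le_tendsto_0.1 hx
  refine ⟨z, tendsto_iff_norm_sub_tendsto_zero.2 (squeeze_zero (fun _ => norm_nonneg _)
    (fun n => ?_) (by simpa using hβ'.const_mul (√K)))⟩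
  have hy : CauchySeq fun m => x n - x m :=
    (cauchySeq_const (x n)).prodMk hx |>.map uniformContinuous_sub
  obtain ⟨v, hv, hvc⟩ := exists_tendsto_mul_self hy (ξ := fun j => (x n).toSeq j - ξ j)
    fun j => (hξ j).const_sub _
  have hvz : mul (x n - z) (x n - z) = v := TwoConv.ext_coord b fun j => by
    rw [coord_mul, hvc, sq]
    rfl
  have hvn : ‖v‖ ≤ β n ^ 2 := by
    refine le_of_tendsto hv.norm (Filter.eventually_atTop.2 ⟨n, fun m hm => ?_⟩)
    have h1 := hβ n m n le_rfl hm
    rw [dist_eq_norm] at h1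
    exact (norm_mul_self_le _).trans (pow_le_pow_left₀ (norm_nonneg _) h1 2)
  refine abs_le_of_sq_le_sq' ?_ (mul_nonneg (Real.sqrt_nonneg _) (hβ0 n)) |>.2
  rw [mul_pow, Real.sq_sqrt hK0]
  refine (sq_norm_le_mul_norm hK _).trans ?_
  rw [hvz]
  exact mul_le_mul_of_nonneg_left hvn hK0

/-! ## Large subspaces vanishing on the first coordinates -/

theorem exists_tail_subspace (E : Submodule ℝ (TwoConvexification b)) [FiniteDimensional ℝ E]
    (k : ℕ) : ∃ V ≤ E, (∀ f ∈ V, ∀ j < k, f.toSeq j = 0) ∧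
      Module.finrank ℝ E ≤ k + Module.finrank ℝ V := by
  let Φ : E →ₗ[ℝ] Fin k → ℝ :=
    { toFun := fun f j => (f : TwoConvexification b).toSeq j
      map_add' := fun _ _ => rfl
      map_smul' := fun _ _ => rfl }
  refine ⟨Φ.ker.map E.subtype, Submodule.map_subtype_le _ _, ?_, ?_⟩
  · rintro _ ⟨f, hf, rfl⟩ j hj
    exact congrFun (LinearMap.mem_ker.1 hf) ⟨j, hj⟩
  · rw [Submodule.finrank_map_subtype_eq, ← Φ.finrank_range_add_finrank_ker]
    have := Submodule.finrank_le Φ.range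
    rw [Module.finrank_fin_fun] at this
    omega

end TwoConvexification

/-! ### Conclusion: choice of the constants -/

open TwoConvexification in
theorem corollary3p2 {X : Type*} [NormedAddCommGroup X] [NormedSpace ℝ X] [CompleteSpace X]
    (b : UnconditionalSchauderBasis ℕ ℝ X) (hX : IsAsymptoticLpDisjoint b 1) :
    IsWeakHilbert (TwoConvexification b) := by
  obtain ⟨C, hC, hX⟩ := hX
  obtain ⟨K₀, hK₀, hK'⟩ := TwoConv.exists_norm_bound b
  -- The bound is enlarged to be strictly positive, so that `D` and `M` are.
  set K : ℝ := K₀ + 1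
  have hK0 : 0 < K := by positivity
  have hK : ∀ u v : X, (∀ i, |b.coord i v| ≤ |b.coord i u|) → ‖v‖ ≤ K * ‖u‖ := fun u v h =>
    (hK' u v h).trans (mul_le_mul_of_nonneg_right (by simp [K]) (norm_nonneg u))
  set D : ℝ := C * C * ((5 : ℕ) * K) with hD
  have hD0 : 0 < D := by positivity
  set M : ℝ := K * (D * (K + 1))
  have hM0 : 0 < M := by positivity
  refine ⟨completeSpace b, 1 / 2, max 1 √M, by norm_num, le_max_left _ _, fun E hE => ?_⟩
  obtain ⟨V, hVE, hV, hdim⟩ := exists_tail_subspace E (Module.finrank ℝ E / 2)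
  have hVfin : FiniteDimensional ℝ V := Submodule.finiteDimensional_of_le hVE
  have hVdim : Module.finrank ℝ V ≤ 2 * (Module.finrank ℝ E / 2 + 1) :=
    (Submodule.finrank_mono hVE).trans (by omega)
  -- With `k = ⌊dim E / 2⌋`, `dim V ≤ 2(k + 1)`, so `(dim V)² + 1 ≤ 5(k + 1)²`: this is the `5` in
  -- `D`.
  obtain ⟨μ, hμ0, hμ1, hμ⟩ := exists_weight hK0.le hD0 hK V hV fun r hr =>
    hasLowerEstimate_of_card_le_sq hC hX hK 5 (by
      rw [Fintype.card_fin]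
      nlinarith [Nat.mul_le_mul hVdim hVdim])
  obtain ⟨T, hT⟩ := exists_map_lp μ hμ0
  obtain ⟨h1, P, hP, h2⟩ := distEuclidean_le_and_exists_projection T
    (fun f => abs_le_of_sq_le_sq' (by
      rw [hT]
      exact (hμ1 _).trans (norm_mul_self_le f)) (norm_nonneg f) |>.2)
    V (Real.sqrt_nonneg M) fun f hf => abs_le_of_sq_le_sq' (by
      rw [mul_pow, Real.sq_sqrt hM0.le, hT]
      exact hμ f hf) (by positivity) |>.2
  refine ⟨V, hVE, ?_, h1.trans (le_max_right _ _), P, hP, h2.trans (le_max_right _ _)⟩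
  have h3 : Module.finrank ℝ E ≤ 2 * Module.finrank ℝ V := by omega
  have h4 : (Module.finrank ℝ E : ℝ) ≤ 2 * Module.finrank ℝ V := by exact_mod_cast h3
  linarith
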